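/- **Setting.** Let $(X,\mathsf d)$ be a proper metric space (closed bounded sets are compact) with a Borel measure $\mathfrak m$ that is finite on bounded sets and doubling: for every $R>0$ there is $C(R)>0$ such that $0<\mathfrak m(B_{2r}(x))\le C(R)\,\mathfrak m(B_r(x))$ for all $x\in X$ and $0<r\le R$. For $x\in X$, a proper pointed metric space $(Y,\mathsf d_Y,y)$ belongs to $\mathrm{Tan}(X,\mathsf d,x)$ if there are $r_i\downarrow 0$ (that is, $r_i>0$, $r_i\to0$), $\varepsilon_i\to 0$, $R_i\to\infty$ (all positive) and maps $f_i$ from the closed ball of radius $R_i$ about $x$ in $(X,\mathsf d/r_i)$ to the closed ball of radius $R_i$ about $y$ in $Y$ with $f_i(x)=y$, which change distances by at most $\varepsilon_i$ and whose image is $\varepsilon_i$-dense in the target ball. We then say that $(r_i,f_i)$ realizes $(X,\mathsf d/r_i,x)\to(Y,\mathsf d_Y,y)$. Let $E\subset X$ be the set of those $x$ for which it fails that for all $(Y,\mathsf d_Y,y)\in\mathrm{Tan}(X,\mathsf d,x)$ and all $z\in Y$ also $(Y,\mathsf d_Y,z)\in\mathrm{Tan}(X,\mathsf d,x)$. Let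 $\Gamma(X)$ be the set of biLipschitz maps $\gamma:\mathrm{Dom}(\gamma)\to X$ with $\mathrm{Dom}(\gamma)\subset\mathbb R$ non-empty and compact. Write $|d\gamma|(t)=c$ if $\mathsf d(\gamma_{t+s_i},\gamma_{t+\tau_i})/|s_i-\tau_i|\to c$ for all sequences $s_i,\tau_i\to0$ with $t+s_i,t+\tau_i\in\mathrm{Dom}(\gamma)$ for which the intervals $J_i$ with endpoints $t+s_i,t+\tau_i$ shrink nicely to $t$, i.e. there are $\alpha>0$ and $\rho_i>0$ with $J_i\subset B_{\rho_i}(t)$ and $\mathcal L^1(J_i)\ge\alpha\,\mathcal L^1(B_{\rho_i}(t))$. **Statement.** The exceptional set $E$ is $\mathfrak m$-null. Moreover, let $\bar x\in X\setminus E$ and let $\gamma\in\Gamma(X)$ be such that $0\in\mathrm{Dom}(\gamma)$, $\gamma_0=\bar x$, $0$ is a point of density one of $\mathrm{Dom}(\gamma)$, and $|d\gamma|(0)$ exists and is positive. Then for every $(X_\infty,\mathsf d_\infty,\bar x_\infty)\in\mathrm{Tan}(X,\mathsf d,\bar x)$ and every $z\in X_\infty$ there is a line through $z$ that is a limit of $\gamma$: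 there are an isometric embedding $\ell:\mathbb R\to X_\infty$ with $\ell(0)=z$, a pair $(r_i,f_i)$ realizing $(X,\mathsf d/r_i,\bar x)\to(X_\infty,\mathsf d_\infty,z)$, and a dense set $D\subset\mathbb R$ such that for every $t\in D$ one has $r_it\in\mathrm{Dom}(\gamma)$ for all large $i$ and $$\lim_{i\to\infty} f_i(\gamma_{r_it})=\ell\big(|d\gamma|(0)\,t\big).$$ -/

import Mathlib

open MeasureTheory Filter Topology Set
open scoped NNReal ENNReal

universe u v

/-- A Borel measure `m` on a metric space is doubling: for each `R > 0` there is a constant `C`,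
depending only on `R`, with `0 < m (B_{2r}(x)) ≤ C * m (B_r(x))` for all `x` and `0 < r ≤ R`. -/
def IsDoublingMeasure {X : Type u} [MetricSpace X] [MeasurableSpace X] (m : Measure X) : Prop :=
  ∀ R : ℝ, 0 < R → ∃ C : ℝ≥0, 0 < C ∧ ∀ (x : X) (r : ℝ), 0 < r → r ≤ R →
    0 < m (Metric.ball x (2 * r)) ∧ m (Metric.ball x (2 * r)) ≤ C * m (Metric.ball x r)

/-- `f` restricts to an `ε`-isometry from the closed ball of radius `R` about `x` in the rescaled
space `(X, d / r)` to the closed ball of radius `R` about `y` in `Y`, with `f x = y`.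
The closed ball of radius `R` for `d / r` is the closed ball of radius `r * R` for `d`; the values
of `f` outside that ball are irrelevant. -/
structure IsApproxIsometryAtScale {X : Type u} {Y : Type v} [MetricSpace X] [MetricSpace Y]
    (x : X) (y : Y) (r ε R : ℝ) (f : X → Y) : Prop where
  map_base : f x = y
  mapsTo : MapsTo f (Metric.closedBall x (r * R)) (Metric.closedBall y R)
  almost_isometric : ∀ a ∈ Metric.closedBall x (r * R), ∀ b ∈ Metric.closedBall x (r * R),
    |dist a b / r - dist (f a) (f b)| ≤ ε
  almost_surjective : ∀ p ∈ Metric.closedBall y R,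
    ∃ a ∈ Metric.closedBall x (r * R), dist (f a) p ≤ ε

/-- The scales `r i → 0` and the maps `f i` realize the pointed Gromov-Hausdorff convergence
`(X, d / r i, x) ⟶ (Y, d, y)`. -/
structure IsBlowUp {X : Type u} {Y : Type v} [MetricSpace X] [MetricSpace Y]
    (x : X) (y : Y) (r : ℕ → ℝ) (f : ℕ → X → Y) : Prop where
  pos : ∀ i, 0 < r i
  tendsto_zero : Tendsto r atTop (𝓝 0)
  approx : ∃ ε R : ℕ → ℝ, (∀ i, 0 < ε i) ∧ (∀ i, 0 < R i) ∧
    Tendsto ε atTop (𝓝 0) ∧ Tendsto R atTop atTop ∧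
    ∀ i, IsApproxIsometryAtScale x y (r i) (ε i) (R i) (f i)

/-- `(Y, y) ∈ Tan(X, x)`: the pointed space `(Y, y)` is a pointed Gromov-Hausdorff limit of
`(X, d / r i, x)` for some `r i → 0`. (To be used for proper `Y`.) -/
def IsTangentSpace {X : Type u} {Y : Type v} [MetricSpace X] [MetricSpace Y]
    (x : X) (y : Y) : Prop :=
  ∃ (r : ℕ → ℝ) (f : ℕ → X → Y), IsBlowUp x y r f

/-- The exceptional set for the change of base point: the points `x` at which it is not true that
for all tangent spaces `(Y, y) ∈ Tan(X, x)` and all `z : Y` also `(Y, z) ∈ Tan(X, x)`. -/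
def exceptionalSet (X : Type u) [MetricSpace X] : Set X :=
  {x | ¬ ∀ (Y : Type v) [MetricSpace Y] [ProperSpace Y] (y : Y),
    IsTangentSpace x y → ∀ z : Y, IsTangentSpace x z}

/-- An element of `Γ(X)`: a biLipschitz map to `X` from a nonempty compact set `dom ⊆ ℝ`.
Only the values of `toFun` on `dom` are meaningful. -/
structure BiLipCurve (X : Type u) [MetricSpace X] where
  dom : Set ℝ
  toFun : ℝ → X
  dom_nonempty : dom.Nonempty
  dom_compact : IsCompact dom
  biLipschitz : ∃ L : ℝ, 0 < L ∧ ∀ s ∈ dom, ∀ t ∈ dom,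
    L⁻¹ * |s - t| ≤ dist (toFun s) (toFun t) ∧ dist (toFun s) (toFun t) ≤ L * |s - t|

/-- The sets `E i ⊆ ℝ` shrink nicely to `x`. -/
def ShrinksNicely (E : ℕ → Set ℝ) (x : ℝ) : Prop :=
  ∃ (ρ : ℕ → ℝ) (α : ℝ), 0 < α ∧ ∀ i, 0 < ρ i ∧ E i ⊆ Metric.ball x (ρ i) ∧
    ENNReal.ofReal α * volume (Metric.ball x (ρ i)) ≤ volume (E i)

/-- `t` is a point of density one of `I ⊆ ℝ`. -/
def IsDensityOnePoint (I : Set ℝ) (t : ℝ) : Prop :=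
  Tendsto (fun ρ : ℝ => volume (I ∩ Metric.ball t ρ) / volume (Metric.ball t ρ))
    (𝓝[>] 0) (𝓝 1)

namespace BiLipCurve

/-- `γ` is metric differentiable at `t` with `|dγ|(t) = c`: one has
`d(γ_{t+s}, γ_{t+τ}) / |s - τ| → c` along all sequences `s, τ → 0` for which the interval with
endpoints `t + s`, `t + τ` (in the domain of `γ`) shrinks nicely to `t`. -/
def HasMetricDifferentialAt {X : Type u} [MetricSpace X] (γ : BiLipCurve X) (t c : ℝ) : Prop :=
  t ∈ γ.dom ∧ ∀ s τ : ℕ → ℝ, Tendsto s atTop (𝓝 0) → Tendsto τ atTop (𝓝 0) →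
    (∀ i, t + s i ∈ γ.dom) → (∀ i, t + τ i ∈ γ.dom) →
    ShrinksNicely (fun i => uIcc (t + s i) (t + τ i)) t →
    Tendsto (fun i => dist (γ.toFun (t + s i)) (γ.toFun (t + τ i)) / |s i - τ i|) atTop (𝓝 c)

/-- The curve `c : ℝ → Y` is a limit of `γ` under some blow-up
`(X, d / r i, γ_0) ⟶ (Y, d, z)` with maps `f i`: on a dense set of times `t`, the rescaled curve
`f i (γ_{r i * t})` is defined for large `i` and converges to `c t`. (For continuous `c`, these
values determine `c`.) -/
def HasLimitCurve {X : Type u} {Y : Type v} [MetricSpace X] [MetricSpace Y]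
    (γ : BiLipCurve X) (z : Y) (c : ℝ → Y) : Prop :=
  ∃ (r : ℕ → ℝ) (f : ℕ → X → Y), IsBlowUp (γ.toFun 0) z r f ∧
    ∃ D : Set ℝ, Dense D ∧ ∀ t ∈ D, (∀ᶠ i in atTop, r i * t ∈ γ.dom) ∧
      Tendsto (fun i => f i (γ.toFun (r i * t))) atTop (𝓝 (c t))

end BiLipCurve

/-! Nullity: suppose `(Y, y)` is tangent at `x` but `(Y, z)` is not. Then for some tolerance no
small rescaling of `X` at `x` itself resembles `(Y, z)`, although arbitrarily small rescalings at
points `x'` with `dist x x' = O(r)` do. One such rescaling, perturbed to a base point in a countable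
dense set and a rational scale, can replace `(Y, z)`, so countably many sets `nearbyMatchSet` cover
`E` (`exceptionalSet_subset`). At a density point of such a set `S`, a ball about `x'` of radius a
small multiple of `r` meets `S`, and rescalings at points of that ball look like the one at `x'`,
which membership in `S` forbids. Hence `S` is null (`measure_nearbyMatchSet`).

Lines: off `E`, blow-ups converging to `(X_∞, z)` exist. Along a subsequence, density one puts `r i
* t` in the domain for almost every `t`, and compactness gives limits at countably many dense times.
The metric differential forces limit distances `c * |s - t|`, so after reparametrization the limit
extends to an isometric line (`exists_line_hasLimitCurve`). -/

/-! ### Approximate correspondences between rescaled pointed spaces -/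

/-- The pointed rescaled spaces `(X, d / r, x)` and `(Z, d / s, z)` are related by a correspondence
of distortion at most `ε` which contains the pair of base points and covers the closed balls of
radius `R` about them. -/
def PointedClose {X : Type*} {Z : Type*} [MetricSpace X] [MetricSpace Z]
    (x : X) (r : ℝ) (z : Z) (s ε R : ℝ) : Prop :=
  ∃ T : X → Z → Prop, T x z ∧
    (∀ a p a' p', T a p → T a' p' → |dist a a' / r - dist p p' / s| ≤ ε) ∧
    (∀ a, dist a x ≤ r * R → ∃ p, T a p) ∧ (∀ p, dist p z ≤ s * R → ∃ a, T a p)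

namespace PointedClose

variable {X Z W : Type*} [MetricSpace X] [MetricSpace Z] [MetricSpace W]
  {x x' : X} {z : Z} {w : W} {r s t ε ε' R R' : ℝ}

theorem symm (h : PointedClose x r z s ε R) : PointedClose z s x r ε R := by
  obtain ⟨T, h0, hd, h1, h2⟩ := h
  exact ⟨fun p a => T a p, h0, fun p a p' a' ha ha' => by
    rw [abs_sub_comm]; exact hd _ _ _ _ ha ha', h2, h1⟩

theorem mono (h : PointedClose x r z s ε R) (hr : 0 ≤ r) (hs : 0 ≤ s) (hε : ε ≤ ε')
    (hR : R' ≤ R) : PointedClose x r z s ε' R' := by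
  obtain ⟨T, h0, hd, h1, h2⟩ := h
  exact ⟨T, h0, fun p a p' a' ha ha' => (hd _ _ _ _ ha ha').trans hε,
    fun a ha => h1 a (ha.trans (mul_le_mul_of_nonneg_left hR hr)),
    fun a ha => h2 a (ha.trans (mul_le_mul_of_nonneg_left hR hs))⟩

/-- One unit of radius is lost because an intermediate partner may lie farther from its base point
by the distortion, which is at most 1. -/
theorem trans (h : PointedClose x r z s ε R) (h' : PointedClose z s w t ε' R)
    (hr : 0 < r) (hs : 0 < s) (ht : 0 < t) (hε : ε ≤ 1) (hε' : ε' ≤ 1) :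
    PointedClose x r w t (ε + ε') (R - 1) := by
  obtain ⟨T, h0, hd, h1, h2⟩ := h
  obtain ⟨T', h0', hd', h1', h2'⟩ := h'
  refine ⟨fun a q => ∃ p, T a p ∧ T' p q, ⟨z, h0, h0'⟩, ?_, ?_, ?_⟩
  · rintro a q a' q' ⟨p, h, h'⟩ ⟨p', k, k'⟩
    have e := abs_le.1 (hd _ _ _ _ h k)
    have e' := abs_le.1 (hd' _ _ _ _ h' k')
    exact abs_le.2 ⟨by linarith, by linarith⟩
  · intro a ha
    obtain ⟨p, hp⟩ := h1 a (ha.trans (mul_le_mul_of_nonneg_left (by linarith) hr.le))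
    have e := abs_le.1 (hd _ _ _ _ hp h0)
    have ha' : dist a x / r ≤ R - 1 := by rw [div_le_iff₀ hr]; linarith
    have hp' : dist p z / s ≤ R := by linarith
    rw [div_le_iff₀ hs] at hp'
    obtain ⟨q, hq⟩ := h1' p (by linarith)
    exact ⟨q, p, hp, hq⟩
  · intro a ha
    obtain ⟨p, hp⟩ := h2' a (ha.trans (mul_le_mul_of_nonneg_left (by linarith) ht.le))
    have e := abs_le.1 (hd' _ _ _ _ hp h0')
    have ha' : dist a w / t ≤ R - 1 := by rw [div_le_iff₀ ht]; linarith
    have hp' : dist p z / s ≤ R := by linarith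
    rw [div_le_iff₀ hs] at hp'
    obtain ⟨q, hq⟩ := h2 p (by linarith)
    exact ⟨q, p, hq, hp⟩

theorem change_base (hr : 0 < r) (h : dist x x' ≤ ε * r) (R : ℝ) :
    PointedClose x r x' r ε R := by
  have hε : 0 ≤ ε := by
    by_contra hc
    have := mul_neg_of_neg_of_pos (not_le.1 hc) hr
    linarith [dist_nonneg (x := x) (y := x')]
  refine ⟨fun a b => a = b ∨ (a = x ∧ b = x'), Or.inr ⟨rfl, rfl⟩, ?_, fun a _ => ⟨a, Or.inl rfl⟩,
    fun a _ => ⟨a, Or.inl rfl⟩⟩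
  intro a p a' p' h1 h2
  rw [← sub_div, abs_div, abs_of_pos hr, div_le_iff₀ hr]
  have key : ∀ b : X, |dist x b - dist x' b| ≤ ε * r := fun b => (abs_dist_sub_le _ _ _).trans h
  have h0 : 0 ≤ ε * r := by positivity
  rcases h1 with rfl | ⟨rfl, rfl⟩ <;> rcases h2 with rfl | ⟨rfl, rfl⟩
  · simpa using h0
  · rw [dist_comm a, dist_comm a]; exact key a
  · exact key _
  · simpa using h0

/-- Two scalings of the same metric differ in proportion to distance, so the diagonal is cut down to
a ball; the factor 2 bounds its diameter. -/
theorem change_scale (hr : 0 < r)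
    (h : 2 * (max r s * R) * |1 / r - 1 / s| ≤ ε) (hR : 0 ≤ R) (x : X) :
    PointedClose x r x s ε R := by
  refine ⟨fun a b => a = b ∧ dist a x ≤ max r s * R, ⟨rfl, ?_⟩, ?_, ?_, ?_⟩
  · rw [dist_self]; positivity
  · rintro a _ a' _ ⟨rfl, h1⟩ ⟨rfl, h2⟩
    have e : dist a a' / r - dist a a' / s = dist a a' * (1 / r - 1 / s) := by ring
    rw [e, abs_mul, abs_of_nonneg dist_nonneg]
    refine le_trans (mul_le_mul_of_nonneg_right ?_ (abs_nonneg _)) h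
    linarith [dist_triangle_right a a' x]
  · exact fun a ha => ⟨a, rfl, ha.trans (mul_le_mul_of_nonneg_right (le_max_left _ _) hR)⟩
  · exact fun a ha => ⟨a, rfl, ha.trans (mul_le_mul_of_nonneg_right (le_max_right _ _) hR)⟩

end PointedClose

/-- Pointed rescalings of `X` can be approximated with base points in a given dense set and
rational scales. -/
theorem exists_rat_pointedClose {X : Type*} [MetricSpace X] {D : Set X} (hD : Dense D)
    (x : X) {r ε R : ℝ} (hr : 0 < r) (hε : 0 < ε) (hε1 : ε ≤ 1) (hR : 0 ≤ R) :
    ∃ w ∈ D, ∃ s : ℚ, 0 < s ∧ PointedClose w (s : ℝ) x r ε R := by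
  have hc : ContinuousAt (fun s : ℝ => 2 * (max s r * (R + 1)) * |1 / s - 1 / r|) r := by
    have : ContinuousAt (fun s : ℝ => 1 / s) r := continuousAt_const.div continuousAt_id hr.ne'
    fun_prop
  have h1 : ∀ᶠ s in 𝓝 r, 2 * (max s r * (R + 1)) * |1 / s - 1 / r| < ε / 2 :=
    hc.eventually_lt_const (by simpa using hε)
  obtain ⟨s, hs1, hs0⟩ := Rat.denseRange_cast.exists_mem_open
    (isOpen_interior (s := {s : ℝ | 2 * (max s r * (R + 1)) * |1 / s - 1 / r| < ε / 2 ∧ 0 < s}))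
    ⟨r, mem_interior_iff_mem_nhds.2 (h1.and (lt_mem_nhds hr))⟩ |>.imp
      (fun s hs => interior_subset hs)
  have hs2 : (0 : ℝ) < s := hs0
  obtain ⟨w, hwD, hw⟩ := hD.exists_dist_lt x (ε := ε / 2 * s) (by positivity)
  refine ⟨w, hwD, s, by exact_mod_cast hs2, ?_⟩
  have a := PointedClose.change_base hs2 ((dist_comm w x).trans_le hw.le) (R + 1)
  have b := PointedClose.change_scale hs2 hs1.le (by linarith) x
  have := a.trans b hs2 hs2 hr (by linarith) (by linarith)
  convert this using 1 <;> ring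

/-! ### Passing between blow-ups and correspondences -/

/-- A blow-up at `(Y, y)` makes `X` close to `(Y, z)` at points at rescaled distance about
`dist y z` from the base point. -/
theorem IsBlowUp.eventually_pointedClose {X : Type u} {Y : Type v} [MetricSpace X] [MetricSpace Y]
    {x : X} {y : Y} {r : ℕ → ℝ} {f : ℕ → X → Y} (h : IsBlowUp x y r f) (z : Y)
    {ε : ℝ} (hε : 0 < ε) (R : ℝ) :
    ∀ᶠ i in atTop, ∃ x', dist x x' ≤ (dist y z + 1) * r i ∧
      PointedClose x' (r i) z 1 ε R := by
  obtain ⟨e, S, he0, hS0, he, hS, hf⟩ := h.approx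
  have h1 : ∀ᶠ i in atTop, e i < min (ε / 3) (1 / 2) := he.eventually_lt_const (by positivity)
  have h2 := hS.eventually_ge_atTop (|R| + dist y z + 1)
  filter_upwards [h1, h2] with i hi1 hi2
  have hr := h.pos i
  have g := hf i
  have e1 : e i < ε / 3 := hi1.trans_le (min_le_left _ _)
  have e2 : e i < 1 / 2 := hi1.trans_le (min_le_right _ _)
  have hRR := le_abs_self R
  have hR0 := abs_nonneg R
  have hyz := dist_nonneg (x := y) (y := z)
  obtain ⟨x', hx', hx'z⟩ := g.almost_surjective z (by
    rw [Metric.mem_closedBall, dist_comm]; linarith)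
  have hxm : x ∈ Metric.closedBall x (r i * S i) :=
    Metric.mem_closedBall_self (mul_nonneg hr.le (hS0 i).le)
  have hd : dist x x' ≤ (dist y z + 1) * r i := by
    have := (abs_le.1 (g.almost_isometric x hxm x' hx')).2
    rw [g.map_base] at this
    rw [← div_le_iff₀ hr]
    linarith [dist_triangle_right y (f i x') z, dist_triangle y z (f i x'), dist_comm z (f i x')]
  refine ⟨x', hd, fun a p => a ∈ Metric.closedBall x (r i * S i) ∧ dist (f i a) p ≤ e i,
    ⟨hx', hx'z⟩, ?_, ?_, ?_⟩
  · rintro a p a' p' ⟨ha, hp⟩ ⟨ha', hp'⟩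
    have k1 := abs_le.1 (g.almost_isometric a ha a' ha')
    have k2 := dist_triangle4 (f i a) p p' (f i a')
    have k3 := dist_triangle4 p (f i a) (f i a') p'
    rw [dist_comm p' (f i a')] at k2
    rw [dist_comm p (f i a)] at k3
    rw [div_one]
    exact abs_le.2 ⟨by linarith, by linarith⟩
  · intro a ha
    refine ⟨f i a, ?_, by rw [dist_self]; exact (he0 i).le⟩
    rw [Metric.mem_closedBall]
    have k : r i * (R + (dist y z + 1)) ≤ r i * S i :=
      mul_le_mul_of_nonneg_left (by linarith) hr.le
    linarith [dist_triangle_right a x x', dist_triangle a x' x, dist_comm x x']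
  · intro p hp
    refine g.almost_surjective p ?_
    rw [Metric.mem_closedBall]
    linarith [dist_triangle_right p y z, dist_triangle p z y, dist_comm y z]

/-- Balls of a suitable radius in a proper space change little when the radius changes little. -/
theorem exists_radius_closedBall_approx {Y : Type*} [MetricSpace Y] [ProperSpace Y] (z : Y)
    {ε : ℝ} (hε : 0 < ε) (R₀ : ℝ) :
    ∃ R η : ℝ, R₀ < R ∧ 0 < η ∧ ∀ p ∈ Metric.closedBall z (R + η),
      ∃ p' ∈ Metric.closedBall z (R - η), dist p p' ≤ ε := by
  by_contra! hc
  have hpow : ∀ j : ℕ, (0 : ℝ) < (1 / 2) ^ j := fun j => by positivity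
  -- Each later point lies in the inner ball of every earlier radius, since `5/4 * 2⁻¹ ≤ 3/4`. The
  -- points are thus more than `ε` apart, against compactness.
  choose p hp hfar using fun j : ℕ => hc (R₀ + (1 / 2) ^ j) ((1 / 2) ^ j / 4)
    (by linarith [hpow j]) (by linarith [hpow j])
  have hmem : ∀ j, p j ∈ Metric.closedBall z (R₀ + 2) := fun j => by
    have h1 : ((1 : ℝ) / 2) ^ j ≤ 1 := pow_le_one₀ (by norm_num) (by norm_num)
    refine Metric.closedBall_subset_closedBall ?_ (hp j)
    linarith
  obtain ⟨q, -, φ, hφ, hlim⟩ := (isCompact_closedBall z (R₀ + 2)).tendsto_subseq hmem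
  obtain ⟨N, hN⟩ := Metric.cauchySeq_iff'.1 hlim.cauchySeq ε hε
  have hlt : φ N < φ (N + 1) := hφ (Nat.lt_succ_self N)
  have hle : ((1 : ℝ) / 2) ^ φ (N + 1) ≤ (1 / 2) ^ (φ N + 1) :=
    pow_le_pow_of_le_one (by norm_num) (by norm_num) hlt
  have hpos := hpow (φ N)
  rw [pow_succ] at hle
  have := hfar (φ N) (p (φ (N + 1))) (Metric.closedBall_subset_closedBall (by linarith)
    (hp (φ (N + 1))))
  have h2 := hN (N + 1) (by omega)
  rw [dist_comm] at h2
  exact absurd h2 (not_lt.2 this.le)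

/-- If `(X, d / r, x)` is arbitrarily close to a proper space `(Y, z)` for arbitrarily small `r`,
then `(Y, z)` is a tangent space of `X` at `x`. -/
theorem isTangentSpace_of_pointedClose {X : Type u} {Y : Type v} [MetricSpace X] [MetricSpace Y]
    [ProperSpace Y] {x : X} {z : Y}
    (h : ∀ k : ℕ, ∃ r : ℝ, 0 < r ∧ r < 1 / ((k : ℝ) + 1) ∧
      PointedClose x r z 1 (1 / ((k : ℝ) + 1)) k) : IsTangentSpace x z := by
  have key : ∀ n : ℕ, ∃ (r R : ℝ) (f : X → Y), 0 < r ∧ r < 1 / ((n : ℝ) + 1) ∧ (n : ℝ) < R ∧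
      IsApproxIsometryAtScale x z r (3 * (1 / ((n : ℝ) + 1))) R f := by
    intro n
    have hε : 0 < 1 / ((n : ℝ) + 1) := by positivity
    set ε := 1 / ((n : ℝ) + 1) with hεdef
    -- At this radius, partners that leave the target ball by less than `η` can be pulled back at
    -- cost `ε`. Two such moves plus the distortion `e < ε` give `3 * ε`.
    obtain ⟨R, η, hR, hη, hball⟩ := exists_radius_closedBall_approx z hε n
    have hRpos : 0 < R := (Nat.cast_nonneg n).trans_lt hR
    obtain ⟨k₁, hk₁⟩ := exists_nat_one_div_lt (lt_min hη hε)
    obtain ⟨k₂, hk₂⟩ := exists_nat_ge R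
    obtain ⟨r, hr, hrk, hcl⟩ := h (max k₁ k₂)
    have hk : 1 / (((max k₁ k₂ : ℕ) : ℝ) + 1) < min η ε :=
      lt_of_le_of_lt (one_div_le_one_div_of_le (by positivity) (by
        have : (k₁ : ℝ) ≤ ((max k₁ k₂ : ℕ) : ℝ) := by exact_mod_cast le_max_left _ _
        linarith)) hk₁
    have hcl' := hcl.mono hr.le zero_le_one le_rfl
      (hk₂.trans (by exact_mod_cast le_max_right _ _ : (k₂ : ℝ) ≤ ((max k₁ k₂ : ℕ) : ℝ)))
    set e := 1 / (((max k₁ k₂ : ℕ) : ℝ) + 1)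
    have heη : e < η := hk.trans_le (min_le_left _ _)
    have heε : e < ε := hk.trans_le (min_le_right _ _)
    obtain ⟨T, h0, hd, h1, h2⟩ := hcl'
    simp only [div_one, one_mul] at hd h2
    have hdist : ∀ a p, T a p → |dist a x / r - dist p z| ≤ e := fun a p hp => hd _ _ _ _ hp h0
    have hf : ∀ a : X, ∃ q : Y, (a = x → q = z) ∧ (dist a x ≤ r * R →
        q ∈ Metric.closedBall z R ∧ ∃ p, T a p ∧ dist p q ≤ ε) := by
      intro a
      by_cases hax : a = x
      · refine ⟨z, fun _ => rfl, fun _ => ⟨Metric.mem_closedBall_self hRpos.le, z, ?_, ?_⟩⟩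
        · rw [hax]; exact h0
        · rw [dist_self]; exact hε.le
      · by_cases had : dist a x ≤ r * R
        · obtain ⟨p, hp⟩ := h1 a had
          have had' : dist a x / r ≤ R := by rw [div_le_iff₀ hr]; linarith
          obtain ⟨q, hq, hpq⟩ := hball p (by
            rw [Metric.mem_closedBall]; linarith [(abs_le.1 (hdist a p hp)).1])
          exact ⟨q, fun h => absurd h hax, fun _ =>
            ⟨Metric.closedBall_subset_closedBall (by linarith) hq, p, hp, hpq⟩⟩
        · exact ⟨z, fun _ => rfl, fun h => absurd h had⟩
    choose f hfx hfb using hf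
    refine ⟨r, R, f, hr, (hrk.trans heε), hR, hfx x rfl, fun a ha => (hfb a ha).1, ?_, ?_⟩
    · intro a ha b hb
      obtain ⟨-, p, hp, hpf⟩ := hfb a ha
      obtain ⟨-, q, hq, hqf⟩ := hfb b hb
      have k1 := abs_le.1 (hd _ _ _ _ hp hq)
      have k2 := dist_triangle4 (f a) p q (f b)
      have k3 := dist_triangle4 p (f a) (f b) q
      rw [dist_comm (f a) p] at k2
      rw [dist_comm (f b) q] at k3
      exact abs_le.2 ⟨by linarith, by linarith⟩
    · intro p hp
      obtain ⟨p', hp', hpp⟩ := hball p (Metric.closedBall_subset_closedBall (by linarith) hp)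
      rw [Metric.mem_closedBall] at hp'
      obtain ⟨a, ha⟩ := h2 p' (by linarith)
      have k1 := (abs_le.1 (hdist a p' ha)).2
      have hda : dist a x ≤ r * R := by
        rw [mul_comm, ← div_le_iff₀ hr]; linarith
      refine ⟨a, hda, ?_⟩
      obtain ⟨-, q, hq, hqf⟩ := hfb a hda
      have k2 := (abs_le.1 (hd _ _ _ _ ha hq)).1
      rw [dist_self, zero_div] at k2
      have k3 := dist_triangle4 (f a) q p' p
      rw [dist_comm (f a) q, dist_comm q p', dist_comm p' p] at k3
      linarith
  choose r R f hr hrn hR hf using key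
  refine ⟨r, f, hr, ?_, fun n => 3 * (1 / ((n : ℝ) + 1)), R, fun n => by positivity,
    fun n => (Nat.cast_nonneg n).trans_lt (hR n), ?_, ?_, hf⟩
  · exact squeeze_zero (fun n => (hr n).le) (fun n => (hrn n).le)
      tendsto_one_div_add_atTop_nhds_zero_nat
  · simpa using (tendsto_one_div_add_atTop_nhds_zero_nat (𝕜 := ℝ)).const_mul 3
  · exact tendsto_atTop_mono (fun n => (hR n).le) tendsto_natCast_atTop_atTop

/-! ### The exceptional set is null -/

theorem IsDoublingMeasure.isUnifLocDoublingMeasure {X : Type u} [MetricSpace X]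
    [MeasurableSpace X] {m : Measure X} (hm : IsDoublingMeasure m) :
    IsUnifLocDoublingMeasure m := by
  obtain ⟨C, -, hC⟩ := hm 2 two_pos
  refine ⟨C * C, ?_⟩
  filter_upwards [Ioc_mem_nhdsGT (zero_lt_one (α := ℝ))] with r hr x
  have h1 := (hC x (2 * r) (by linarith [hr.1]) (by linarith [hr.2])).2
  have h2 := (hC x r hr.1 (by linarith [hr.2])).2
  calc m (Metric.closedBall x (2 * r)) ≤ m (Metric.ball x (2 * (2 * r))) :=
        measure_mono (Metric.closedBall_subset_ball (by linarith [hr.1]))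
    _ ≤ C * (C * m (Metric.ball x r)) := h1.trans (by gcongr)
    _ ≤ C * (C * m (Metric.closedBall x r)) := by gcongr; exact Metric.ball_subset_closedBall
    _ = ↑(C * C) * m (Metric.closedBall x r) := by rw [ENNReal.coe_mul, mul_assoc]

/-- The points `x` such that `(X, d / r, x')` is close to `(X, d / s, w)` for some points `x'` with
`dist x x' = O(r)` and arbitrarily small `r`, while `(X, d / r, x)` itself is not close to
`(X, d / s, w)` for any small `r`. -/
def nearbyMatchSet {X : Type*} [MetricSpace X] (k : ℕ) (w : X) (s : ℝ) : Set X :=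
  {x | (∃ C : ℝ, ∀ δ > 0, ∃ r, 0 < r ∧ r < δ ∧ ∃ x', dist x x' ≤ C * r ∧
      PointedClose x' r w s (1 / ((k : ℝ) + 1) / 2) (k + 2)) ∧
    ∀ r, 0 < r → r < 1 / ((k : ℝ) + 1) →
      ¬ PointedClose x r w s (3 * (1 / ((k : ℝ) + 1)) / 4) (k + 1)}

theorem measure_nearbyMatchSet {X : Type u} [MetricSpace X] [ProperSpace X] [MeasurableSpace X]
    [BorelSpace X] (m : Measure X) [IsFiniteMeasureOnCompacts m] (hm : IsDoublingMeasure m)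
    (k : ℕ) (w : X) {s : ℝ} (hs : 0 < s) : m (nearbyMatchSet k w s) = 0 := by
  have := hm.isUnifLocDoublingMeasure
  set S := nearbyMatchSet k w s with hS
  -- Off-centre Lebesgue density, simultaneously for all `K` because the constant `C` in
  -- `nearbyMatchSet` depends on the point. Measurability of `S` is not needed.
  have hae : ∀ᵐ x ∂m.restrict S, ∀ K : ℕ, ∀ (y : ℕ → X) (δ : ℕ → ℝ)
      (_ : Tendsto δ atTop (𝓝[>] 0)) (_ : ∀ᶠ j in atTop, x ∈ Metric.closedBall (y j) (K * δ j)),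
      Tendsto (fun j => m (S ∩ Metric.closedBall (y j) (δ j)) / m (Metric.closedBall (y j) (δ j)))
        atTop (𝓝 1) := by
    rw [ae_all_iff]
    intro K
    filter_upwards [IsUnifLocDoublingMeasure.ae_tendsto_measure_inter_div m S K] with x hx y δ h1 h2
    exact hx y δ h1 h2
  rw [← Measure.restrict_apply_self m S]
  refine measure_mono_null (fun x hx => ?_) (ae_iff.1 hae)
  intro hgood
  obtain ⟨⟨C, hC⟩, -⟩ := hx
  have hε : 0 < 1 / ((k : ℝ) + 1) := by positivity
  have hε1 : 1 / ((k : ℝ) + 1) ≤ 1 := by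
    rw [div_le_one (by positivity)]; linarith [Nat.cast_nonneg (α := ℝ) k]
  have hnot : ∀ a ∈ S, ∀ r, 0 < r → r < 1 / ((k : ℝ) + 1) →
      ¬ PointedClose a r w s (3 * (1 / ((k : ℝ) + 1)) / 4) (k + 1) := fun a ha => ha.2
  set ε := 1 / ((k : ℝ) + 1)
  choose r hr hrn y hy hcl using fun n : ℕ => hC (1 / ((n : ℝ) + 1)) (by positivity)
  have hr0 : Tendsto r atTop (𝓝 0) := squeeze_zero (fun n => (hr n).le) (fun n => (hrn n).le)
      tendsto_one_div_add_atTop_nhds_zero_nat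
  obtain ⟨K, hK⟩ := exists_nat_ge (C / (ε / 4))
  have hlim := hgood K y (fun n => ε / 4 * r n) (by
      rw [tendsto_nhdsWithin_iff]
      refine ⟨by simpa using hr0.const_mul (ε / 4), Eventually.of_forall fun n => ?_⟩
      exact mul_pos (by linarith) (hr n))
    (Eventually.of_forall fun n => by
      rw [Metric.mem_closedBall]
      refine (hy n).trans ?_
      rw [div_le_iff₀ (by linarith)] at hK
      rw [← mul_assoc]
      exact mul_le_mul_of_nonneg_right hK (hr n).le)
  obtain ⟨n, hn1, hn2⟩ := ((hlim.eventually_ne one_ne_zero).and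
    (hr0.eventually_lt_const hε)).exists
  have hne : (S ∩ Metric.closedBall (y n) (ε / 4 * r n)).Nonempty := by
    rw [nonempty_iff_ne_empty]
    intro h0
    rw [h0, measure_empty, ENNReal.zero_div] at hn1
    exact hn1 rfl
  obtain ⟨a, haS, ha⟩ := hne
  refine hnot a haS (r n) (hr n) hn2 ?_
  -- Moving the base point costs `ε / 4` and the match costs `ε / 2`: exactly the forbidden `3 * ε /
  -- 4`, at radius `k + 1`.
  have h1 := (PointedClose.change_base (hr n) (Metric.mem_closedBall.1 ha) ((k : ℝ) + 2)).trans
    (hcl n) (hr n) (hr n) hs (by linarith) (by linarith)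
  exact h1.mono (hr n).le hs.le (by linarith) (by linarith)

theorem exceptionalSet_subset {X : Type u} [MetricSpace X] {D : Set X} (hD : Dense D) :
    exceptionalSet.{u, v} X ⊆
      ⋃ (k : ℕ), ⋃ w ∈ D, ⋃ (s : ℚ), ⋃ (_ : 0 < s), nearbyMatchSet k w (s : ℝ) := by
  intro x hx
  simp only [exceptionalSet, mem_ofPred_eq, not_forall] at hx
  obtain ⟨Y, _, _, y, ⟨r, f, hrf⟩, z, hz⟩ := hx
  have hk : ∃ k : ℕ, ∀ r : ℝ, 0 < r → r < 1 / ((k : ℝ) + 1) →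
      ¬ PointedClose x r z 1 (1 / ((k : ℝ) + 1)) k := by
    by_contra! hc
    exact hz (isTangentSpace_of_pointedClose hc)
  obtain ⟨k, hk⟩ := hk
  have hε : 0 < 1 / ((k : ℝ) + 1) := by positivity
  have hε1 : 1 / ((k : ℝ) + 1) ≤ 1 := by
    rw [div_le_one (by positivity)]; linarith [Nat.cast_nonneg (α := ℝ) k]
  -- Error budget, with `ε = 1 / (k + 1)`: two steps of `ε / 8` link `w` to `z` within `ε / 4`. Then
  -- `x'` to `w` costs `ε / 2`, and a match of `x` with `w` within `3 * ε / 4` would give `x` to `z`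
  -- within `ε`. The radius `k + 5` absorbs the unit losses.
  obtain ⟨i, x₀, -, hx₀⟩ := (hrf.eventually_pointedClose z
    (ε := 1 / ((k : ℝ) + 1) / 8) (by positivity) (k + 5)).exists
  obtain ⟨w, hwD, s, hs, hws⟩ := exists_rat_pointedClose hD x₀ (hrf.pos i)
    (ε := 1 / ((k : ℝ) + 1) / 8) (R := k + 5) (by positivity) (by linarith) (by positivity)
  have hs' : (0 : ℝ) < s := by exact_mod_cast hs
  have hwz := hws.trans hx₀ hs' (hrf.pos i) one_pos (by linarith) (by linarith)
  simp only [mem_iUnion]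
  refine ⟨k, w, hwD, s, hs, ⟨dist y z + 1, fun δ hδ => ?_⟩, fun r hr hrk hcl => ?_⟩
  · obtain ⟨j, ⟨x', hx', hc⟩, hj⟩ := ((hrf.eventually_pointedClose z
      (ε := 1 / ((k : ℝ) + 1) / 4) (by positivity) (k + 5 - 1)).and
      (hrf.tendsto_zero.eventually_lt_const hδ)).exists
    refine ⟨r j, hrf.pos j, hj, x', hx', ?_⟩
    exact (hc.trans hwz.symm (hrf.pos j) one_pos hs' (by linarith) (by linarith)).mono
      (hrf.pos j).le hs'.le (by linarith) (by linarith)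
  · have h1 := hwz.mono hs'.le zero_le_one le_rfl (by linarith : (k : ℝ) + 1 ≤ k + 5 - 1)
    exact hk r hr hrk ((hcl.trans h1 hr hs' one_pos (by linarith) (by linarith)).mono hr.le
      zero_le_one (by linarith) (by linarith))

theorem measure_exceptionalSet {X : Type u} [MetricSpace X] [ProperSpace X] [MeasurableSpace X]
    [BorelSpace X] (m : Measure X) [IsFiniteMeasureOnCompacts m] (hm : IsDoublingMeasure m) :
    m (exceptionalSet.{u, v} X) = 0 := by
  obtain ⟨D, hDc, hD⟩ := TopologicalSpace.exists_countable_dense X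
  refine measure_mono_null (exceptionalSet_subset hD) ?_
  refine measure_iUnion_null fun k => (measure_biUnion_null_iff hDc).2 fun w _ =>
    measure_iUnion_null fun s => measure_iUnion_null fun hs => ?_
  exact measure_nearbyMatchSet m hm k w (by exact_mod_cast hs)

/-! ### Limits of curves under blow-ups -/

theorem IsBlowUp.comp_strictMono {X : Type u} {Y : Type v} [MetricSpace X] [MetricSpace Y]
    {x : X} {y : Y} {r : ℕ → ℝ} {f : ℕ → X → Y} (h : IsBlowUp x y r f) {φ : ℕ → ℕ}
    (hφ : StrictMono φ) : IsBlowUp x y (r ∘ φ) (f ∘ φ) := by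
  obtain ⟨e, S, he0, hS0, he, hS, hf⟩ := h.approx
  exact ⟨fun i => h.pos _, h.tendsto_zero.comp hφ.tendsto_atTop, e ∘ φ, S ∘ φ, fun i => he0 _,
    fun i => hS0 _, he.comp hφ.tendsto_atTop, hS.comp hφ.tendsto_atTop, fun i => hf _⟩

theorem IsBlowUp.tendsto_dist_sub {X : Type u} {Y : Type v} [MetricSpace X] [MetricSpace Y]
    {x : X} {y : Y} {r : ℕ → ℝ} {f : ℕ → X → Y} (h : IsBlowUp x y r f) {a b : ℕ → X} {A B : ℝ}
    (ha : ∀ᶠ i in atTop, dist (a i) x ≤ r i * A) (hb : ∀ᶠ i in atTop, dist (b i) x ≤ r i * B) :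
    Tendsto (fun i => dist (a i) (b i) / r i - dist (f i (a i)) (f i (b i))) atTop (𝓝 0) := by
  obtain ⟨e, S, he0, hS0, he, hS, hf⟩ := h.approx
  refine squeeze_zero_norm' ?_ he
  filter_upwards [ha, hb, hS.eventually_ge_atTop A, hS.eventually_ge_atTop B] with i h1 h2 h3 h4
  exact (hf i).almost_isometric _ (h1.trans (mul_le_mul_of_nonneg_left h3 (h.pos i).le))
    _ (h2.trans (mul_le_mul_of_nonneg_left h4 (h.pos i).le))

theorem IsBlowUp.map_base {X : Type u} {Y : Type v} [MetricSpace X] [MetricSpace Y]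
    {x : X} {y : Y} {r : ℕ → ℝ} {f : ℕ → X → Y} (h : IsBlowUp x y r f) (i : ℕ) : f i x = y := by
  obtain ⟨e, S, -, -, -, -, hf⟩ := h.approx
  exact (hf i).map_base

theorem IsDensityOnePoint.tendsto_measure_diff {I : Set ℝ} (hI : MeasurableSet I) {t : ℝ}
    (h : IsDensityOnePoint I t) :
    Tendsto (fun ρ : ℝ => volume (Metric.ball t ρ \ I) / volume (Metric.ball t ρ))
      (𝓝[>] 0) (𝓝 0) := by
  have h1 := ENNReal.Tendsto.sub (tendsto_const_nhds (x := (1 : ℝ≥0∞)) (f := 𝓝[>] (0 : ℝ))) h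
    (Or.inl ENNReal.one_ne_top)
  rw [tsub_self] at h1
  refine h1.congr' ?_
  filter_upwards [self_mem_nhdsWithin] with ρ hρ
  have hpos : volume (Metric.ball t ρ) ≠ 0 := (Metric.measure_ball_pos volume t hρ).ne'
  have hfin : volume (Metric.ball t ρ) ≠ ∞ := measure_ball_lt_top.ne
  have : volume (Metric.ball t ρ \ I) = volume (Metric.ball t ρ) - volume (I ∩ Metric.ball t ρ) := by
    rw [← sdiff_inter_self_eq_sdiff, measure_sdiff inter_subset_right
      (hI.inter measurableSet_ball).nullMeasurableSet
      (measure_ne_top_of_subset inter_subset_right hfin)]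
  rw [this, ENNReal.sub_div (fun _ _ => hpos), ENNReal.div_self hpos hfin]

/-- Along a subsequence of any scales `r i → 0`, almost every `t` satisfies `r i * t ∈ I` for all
large `i`, if `0` is a density point of `I`. -/
theorem IsDensityOnePoint.exists_subseq_ae_eventually_mem {I : Set ℝ} (hI : MeasurableSet I)
    (h : IsDensityOnePoint I 0) {r : ℕ → ℝ} (hr : ∀ i, 0 < r i) (hr0 : Tendsto r atTop (𝓝 0)) :
    ∃ φ : ℕ → ℕ, StrictMono φ ∧ ∀ᵐ t : ℝ, ∀ᶠ i in atTop, r (φ i) * t ∈ I := by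
  let S : ℕ → ℕ → Set ℝ := fun n i =>
    (fun t => r i * t) ⁻¹' (Metric.ball 0 (r i * ((n : ℝ) + 1)) \ I)
  have hS : ∀ n, Tendsto (fun i => volume (S n i)) atTop (𝓝 0) := by
    intro n
    have hn : 0 < (n : ℝ) + 1 := by positivity
    have hρ : Tendsto (fun i => r i * ((n : ℝ) + 1)) atTop (𝓝[>] 0) := by
      rw [tendsto_nhdsWithin_iff]
      exact ⟨by simpa using hr0.mul_const ((n : ℝ) + 1),
        Eventually.of_forall fun i => mul_pos (hr i) hn⟩
    have h1 := ENNReal.Tendsto.mul_const (b := ENNReal.ofReal (2 * ((n : ℝ) + 1)))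
      ((h.tendsto_measure_diff hI).comp hρ) (Or.inr ENNReal.ofReal_ne_top)
    rw [zero_mul] at h1
    refine h1.congr fun i => ?_
    have hri := hr i
    simp only [S, Function.comp]
    rw [Real.volume_preimage_mul_left hri.ne', Real.volume_ball, ENNReal.div_eq_inv_mul,
      mul_right_comm, abs_of_pos (inv_pos.2 hri),
      ← ENNReal.ofReal_inv_of_pos (by positivity), ← ENNReal.ofReal_mul (by positivity)]
    congr 2
    field_simp
  -- Borel–Cantelli: the bad times in a window growing with `n` have summable measure along `φ`.
  obtain ⟨φ, hφ, hφS⟩ := extraction_forall_of_eventually (fun n =>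
    (hS n).eventually_lt_const (show (0 : ℝ≥0∞) < 2⁻¹ ^ n from by
      exact ENNReal.pow_pos (by simp) n))
  refine ⟨φ, hφ, ?_⟩
  have hsum : ∑' n, volume (S n (φ n)) ≠ ∞ := by
    refine ne_top_of_le_ne_top ?_ (ENNReal.tsum_le_tsum fun n => (hφS n).le)
    rw [ENNReal.tsum_geometric, ENNReal.one_sub_inv_two, inv_inv]
    exact ENNReal.ofNat_ne_top
  filter_upwards [ae_eventually_notMem hsum] with t ht
  obtain ⟨N, hN⟩ := exists_nat_gt |t|
  filter_upwards [ht, eventually_ge_atTop N] with i hi hiN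
  by_contra hc
  refine hi ⟨?_, hc⟩
  have : (N : ℝ) ≤ i := by exact_mod_cast hiN
  rw [mem_ball_zero_iff, Real.norm_eq_abs, abs_mul, abs_of_pos (hr _)]
  exact mul_lt_mul_of_pos_left (by linarith) (hr _)

/-- Rescaled distances along a curve converge to `c * |a - b|`. -/
theorem BiLipCurve.HasMetricDifferentialAt.tendsto_dist_div {X : Type u} [MetricSpace X]
    {γ : BiLipCurve X} {c : ℝ} (h : γ.HasMetricDifferentialAt 0 c) {r : ℕ → ℝ}
    (hr : ∀ i, 0 < r i) (hr0 : Tendsto r atTop (𝓝 0)) {a b : ℝ}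
    (ha : ∀ᶠ i in atTop, r i * a ∈ γ.dom) (hb : ∀ᶠ i in atTop, r i * b ∈ γ.dom) :
    Tendsto (fun i => dist (γ.toFun (r i * a)) (γ.toFun (r i * b)) / r i) atTop
      (𝓝 (c * |a - b|)) := by
  rcases eq_or_ne a b with rfl | hab
  · simp
  have hab' : 0 < |a - b| := abs_pos.2 (sub_ne_zero.2 hab)
  obtain ⟨N, hN⟩ := eventually_atTop.1 (ha.and hb)
  -- The metric differential requires domain membership at every index, hence the shift.
  rw [← tendsto_add_atTop_iff_nat N]
  have hr0' : Tendsto (fun i => r (i + N)) atTop (𝓝 0) := (tendsto_add_atTop_iff_nat N).2 hr0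
  have hM : 0 < |a| + |b| + 1 := by positivity
  have hs := h.2 (fun i => r (i + N) * a) (fun i => r (i + N) * b)
    (by simpa using hr0'.mul_const a) (by simpa using hr0'.mul_const b)
    (fun i => by simpa using (hN (i + N) (by omega)).1)
    (fun i => by simpa using (hN (i + N) (by omega)).2)
    ⟨fun i => r (i + N) * (|a| + |b| + 1), |a - b| / (2 * (|a| + |b| + 1)), by positivity,
      fun i => ⟨mul_pos (hr _) hM, ?_, ?_⟩⟩
  · refine (hs.mul_const |a - b|).congr fun i => ?_
    have := hr (i + N)
    rw [← mul_sub, abs_mul, abs_of_pos this, zero_add, zero_add]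
    field_simp
  · intro t ht
    have hri := hr (i + N)
    have key : ∀ u : ℝ, |u| < |a| + |b| + 1 →
        0 + r (i + N) * u ∈ Metric.ball (0 : ℝ) (r (i + N) * (|a| + |b| + 1)) := fun u hu => by
      rw [zero_add, mem_ball_zero_iff, Real.norm_eq_abs, abs_mul, abs_of_pos hri]
      exact mul_lt_mul_of_pos_left hu hri
    exact (convex_ball (0 : ℝ) _).ordConnected.uIcc_subset
      (key a (by linarith [abs_nonneg b])) (key b (by linarith [abs_nonneg a])) ht
  · have hri := hr (i + N)
    rw [Real.volume_ball, Real.volume_interval, ← ENNReal.ofReal_mul (by positivity)]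
    apply ENNReal.ofReal_le_ofReal
    rw [zero_add, zero_add, ← mul_sub, abs_mul, abs_of_pos hri, abs_sub_comm b a]
    apply le_of_eq
    field_simp

/-- A map which is isometric on a dense set of reals extends to an isometry. -/
theorem exists_isometry_extension {Y : Type*} [MetricSpace Y] [CompleteSpace Y] {D : Set ℝ}
    (hD : Dense D) (g : ℝ → Y) (hg : ∀ s ∈ D, ∀ t ∈ D, dist (g s) (g t) = dist s t) :
    ∃ l : ℝ → Y, Isometry l ∧ ∀ t ∈ D, l t = g t := by
  have hiso : Isometry (fun t : D => g t) := Isometry.of_dist_eq fun s t => hg s s.2 t t.2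
  have hind : IsUniformInducing ((↑) : D → ℝ) := isUniformInducing_val D
  have hdr : DenseRange ((↑) : D → ℝ) := hD.denseRange_val
  have hc := uniformContinuous_uniformly_extend hind hdr hiso.uniformContinuous
  have heq : ∀ t : D, (hind.isDenseInducing hdr).extend (fun t : D => g t) t = g t := fun t =>
    uniformly_extend_of_ind hind hdr hiso.uniformContinuous t
  refine ⟨_, Isometry.of_dist_eq fun s t => ?_, fun t ht => heq ⟨t, ht⟩⟩
  refine hdr.induction_on₂ (isClosed_eq ?_ ?_) (fun s t => ?_) s t
  · exact (hc.continuous.comp continuous_fst).dist (hc.continuous.comp continuous_snd)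
  · exact continuous_fst.dist continuous_snd
  · rw [heq, heq]; exact hiso.dist_eq s t

/-- A sequence of functions on a countable set which is eventually bounded at each point, with
values in a proper space, has a pointwise convergent subsequence. -/
theorem exists_subseq_tendsto_of_eventually_bounded {Y : Type*} [MetricSpace Y] [ProperSpace Y]
    (z : Y) {D : Set ℝ} (hD : D.Countable) (F : ℕ → ℝ → Y) (B : ℝ → ℝ) (hB : ∀ t, 0 ≤ B t)
    (hF : ∀ t ∈ D, ∀ᶠ i in atTop, dist (F i t) z ≤ B t) :
    ∃ φ : ℕ → ℕ, StrictMono φ ∧ ∃ g : ℝ → Y, ∀ t ∈ D,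
      Tendsto (fun i => F (φ i) t) atTop (𝓝 (g t)) := by
  classical
  have := hD.to_subtype
  -- Truncation places the whole sequence in a compact product, changing only finitely many terms at
  -- each `t`.
  let G : ℕ → D → Y := fun i t => if dist (F i t) z ≤ B t then F i t else z
  have hK : IsCompact (Set.pi univ fun t : D => Metric.closedBall z (B t)) :=
    isCompact_univ_pi fun t => isCompact_closedBall _ _
  obtain ⟨g, -, φ, hφ, hlim⟩ := hK.tendsto_subseq (x := G) (fun i t _ => by
    simp only [G]
    split_ifs with h
    · exact h
    · exact Metric.mem_closedBall_self (hB t))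
  refine ⟨φ, hφ, fun t => if ht : t ∈ D then g ⟨t, ht⟩ else z, fun t ht => ?_⟩
  simp only [dif_pos ht]
  refine ((tendsto_pi_nhds.1 hlim) ⟨t, ht⟩).congr' ?_
  filter_upwards [hφ.tendsto_atTop.eventually (hF t ht)] with i hi
  exact if_pos hi

theorem BiLipCurve.exists_line_hasLimitCurve {X : Type u} [MetricSpace X] (γ : BiLipCurve X)
    (hdens : IsDensityOnePoint γ.dom 0) {c : ℝ} (hγ : γ.HasMetricDifferentialAt 0 c) (hc : 0 < c)
    {Y : Type v} [MetricSpace Y] [ProperSpace Y] {z : Y} (hz : IsTangentSpace (γ.toFun 0) z) :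
    ∃ l : ℝ → Y, Isometry l ∧ l 0 = z ∧ γ.HasLimitCurve z (fun t => l (c * t)) := by
  obtain ⟨r₀, f₀, hb₀⟩ := hz
  obtain ⟨φ, hφ, hae⟩ := hdens.exists_subseq_ae_eventually_mem
    γ.dom_compact.measurableSet hb₀.pos hb₀.tendsto_zero
  have hb₁ := hb₀.comp_strictMono hφ
  obtain ⟨D₀, hDsub, hDc, hD₀⟩ := (Measure.dense_of_ae hae).exists_countable_dense_subset
  obtain ⟨L, hL, hLip⟩ := γ.biLipschitz
  -- Time 0 is added so that the limit passes through `z` there.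
  obtain ⟨D, h0D, hDc, hD, hdom₁⟩ : ∃ D : Set ℝ, 0 ∈ D ∧ D.Countable ∧ Dense D ∧
      ∀ t ∈ D, ∀ᶠ i in atTop, (r₀ ∘ φ) i * t ∈ γ.dom := by
    refine ⟨insert 0 D₀, mem_insert _ _, hDc.insert 0, hD₀.mono (subset_insert _ _), ?_⟩
    rintro t (rfl | ht)
    · exact Eventually.of_forall fun i => by rw [mul_zero]; exact hγ.1
    · exact hDsub ht
  have hbd : ∀ t ∈ D, ∀ᶠ i in atTop,
      dist (γ.toFun ((r₀ ∘ φ) i * t)) (γ.toFun 0) ≤ (r₀ ∘ φ) i * (L * |t|) := by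
    intro t ht
    filter_upwards [hdom₁ t ht] with i hi
    have := (hLip _ hi 0 hγ.1).2
    rw [sub_zero, abs_mul, abs_of_pos (hb₁.pos i)] at this
    linarith
  obtain ⟨ψ, hψ, g, hg⟩ := exists_subseq_tendsto_of_eventually_bounded z hDc
    (fun i t => (f₀ ∘ φ) i (γ.toFun ((r₀ ∘ φ) i * t))) (fun t => L * |t| + 1)
    (fun t => by positivity) (by
      intro t ht
      have h1 := hb₁.tendsto_dist_sub (hbd t ht) (b := fun _ => γ.toFun 0) (B := 0)
        (Eventually.of_forall fun i => by simp)
      filter_upwards [h1.eventually_const_lt (show (-1 : ℝ) < 0 by norm_num), hbd t ht]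
        with i hi hi'
      rw [hb₁.map_base i] at hi
      rw [← div_le_iff₀' (hb₁.pos i)] at hi'
      linarith)
  have hb := hb₁.comp_strictMono hψ
  have hdom : ∀ t ∈ D, ∀ᶠ i in atTop, ((r₀ ∘ φ) ∘ ψ) i * t ∈ γ.dom := fun t ht =>
    hψ.tendsto_atTop.eventually (hdom₁ t ht)
  have hdist : ∀ s ∈ D, ∀ t ∈ D, dist (g s) (g t) = c * |s - t| := by
    intro s hs t ht
    have h1 := (hγ.tendsto_dist_div hb.pos hb.tendsto_zero (hdom s hs) (hdom t ht)).sub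
      (hb.tendsto_dist_sub (hψ.tendsto_atTop.eventually (hbd s hs))
        (hψ.tendsto_atTop.eventually (hbd t ht)))
    rw [sub_zero] at h1
    refine tendsto_nhds_unique ((hg s hs).dist (hg t ht)) (h1.congr fun i => ?_)
    exact sub_sub_cancel _ _
  have hg0 : g 0 = z := by
    refine tendsto_nhds_unique (hg 0 h0D) (tendsto_const_nhds.congr fun i => ?_)
    rw [mul_zero]
    exact (hb.map_base i).symm
  have hcD : Dense ((fun t => c * t) '' D) := by
    refine (Function.Surjective.denseRange fun y => ⟨y / c, ?_⟩).dense_image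
      (continuous_const_mul c) hD
    field_simp
  obtain ⟨l, hl, hlg⟩ := exists_isometry_extension hcD (fun t => g (t / c)) (by
    rintro _ ⟨s, hs, rfl⟩ _ ⟨t, ht, rfl⟩
    simp only [mul_div_cancel_left₀ _ hc.ne']
    rw [hdist s hs t ht, Real.dist_eq, ← mul_sub, abs_mul, abs_of_pos hc])
  have hlD : ∀ t ∈ D, l (c * t) = g t := fun t ht => by
    rw [hlg _ ⟨t, ht, rfl⟩, mul_div_cancel_left₀ _ hc.ne']
  refine ⟨l, hl, ?_, (r₀ ∘ φ) ∘ ψ, (f₀ ∘ φ) ∘ ψ, hb, D, hD, fun t ht => ⟨hdom t ht, ?_⟩⟩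
  · have := hlD 0 h0D
    rwa [mul_zero, hg0] at this
  · simp only [hlD t ht]
    exact hg t ht

theorem corollary3p10 {X : Type u} [MetricSpace X] [ProperSpace X] [MeasurableSpace X]
    [BorelSpace X] (m : Measure X) [IsFiniteMeasureOnCompacts m] (hm : IsDoublingMeasure m) :
    m (exceptionalSet.{u, v} X) = 0 ∧
    ∀ x : X, x ∉ exceptionalSet.{u, v} X →
    ∀ γ : BiLipCurve X, 0 ∈ γ.dom → γ.toFun 0 = x → IsDensityOnePoint γ.dom 0 →
    ∀ c : ℝ, γ.HasMetricDifferentialAt 0 c → 0 < c →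
    ∀ (Y : Type v) [MetricSpace Y] [ProperSpace Y] (y : Y), IsTangentSpace x y →
    ∀ z : Y, ∃ l : ℝ → Y, Isometry l ∧ l 0 = z ∧ γ.HasLimitCurve z (fun t => l (c * t)) := by
  refine ⟨measure_exceptionalSet m hm, ?_⟩
  rintro x hx γ - rfl hdens c hγ hc Y _ _ y hy z
  simp only [exceptionalSet, mem_ofPred_eq, not_not] at hx
  exact γ.exists_line_hasLimitCurve hdens hγ hc (hx Y y hy z)
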